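/- Let $X$ be a compact metric space with its Borel $\sigma$-algebra, let $T:X\to X$ be continuous, and let $\mathcal M_{\rm inv}$ be the set of $T$-invariant Borel probability measures on $X$. For $\mu\in\mathcal M_{\rm inv}$ let $h_\mu\in[0,\infty]$ be its measure-theoretic (Kolmogorov--Sinai) entropy and let $$G_\mu=\Big\{x\in X:\ \tfrac1n\sum_{j=0}^{n-1}\delta_{T^jx}\to\mu\ \text{ in the weak-}*\text{ topology}\Big\}.$$ For $Z\subset X$ let $h_{\rm top}(Z)\in[0,\infty]$ be Bowen's topological entropy. It is defined as follows. Put $B_n(x,\epsilon)=\{y:\ d(T^jx,T^jy)<\epsilon \text{ for } 0\le j<n\}$ for $n\ge1$ and $\epsilon>0$. For $s\ge0$ let $H^s_N(Z,\epsilon)=\inf\sum_i e^{-sn_i}$, the infimum over all at most countable covers $\{B_{n_i}(x_i,\epsilon)\}_i$ of $Z$ with $n_i\ge N$ for all $i$, and put $H^s(Z,\epsilon)=\lim_{N\to\infty}H^s_N(Z,\epsilon)$. Then $h_{\rm top}(Z,\epsilon)=\inf\{s\ge0: H^s(Z,\epsilon)=0\}$ (with $\inf\emptyset=\infty$) and $h_{\rm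 top}(Z)=\lim_{\epsilon\to0}h_{\rm top}(Z,\epsilon)$; in particular $h_{\rm top}(\emptyset)=0$. Suppose that $(X,T)$ is saturated, that is, $h_{\rm top}(G_\mu)=h_\mu$ for every $\mu\in\mathcal M_{\rm inv}$. Let $I$ be a finite or countably infinite index set, let $\{\Phi_i\}_{i\in I}$ be a family of continuous functions $X\to\mathbb R$ with $\sup_{i\in I}\sup_{x\in X}|\Phi_i(x)|<\infty$, and let $\mathbf a=(a_i)_{i\in I}$ and $\mathbf b=(b_i)_{i\in I}$ be families of real numbers. Write $A_n\Phi_i(x)=\frac1n\sum_{j=0}^{n-1}\Phi_i(T^jx)$ and $$S(\mathbf a,\mathbf b)=\Big\{x\in X:\ a_i\le\liminf_{n\to\infty}A_n\Phi_i(x)\le\limsup_{n\to\infty}A_n\Phi_i(x)\le b_i\ \text{ for all } i\in I\Big\},$$ $$\mathcal M(\mathbf a,\mathbf b)=\Big\{\mu\in\mathcal M_{\rm inv}:\ a_i\le\int\Phi_i\,d\mu\le b_i\ \text{ for all } i\in I\Big\}.$$ Then $$h_{\rm top}\big(S(\mathbf a,\mathbf b)\big)=\sup_{\mu\in\mathcal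 M(\mathbf a,\mathbf b)}h_\mu ,$$ where the supremum of the empty set is $0$; moreover, if $\mathcal M(\mathbf a,\mathbf b)=\emptyset$, then $S(\mathbf a,\mathbf b)=\emptyset$. -/

import Mathlib

open MeasureTheory Filter Topology
open scoped ENNReal NNReal

noncomputable section

namespace SaturatedSystem

/-! ### Bowen's topological entropy of an arbitrary subset -/

section Topological

variable {X : Type*} [MetricSpace X]

/-- The open ball `B_n(x, ε)` of the Bowen metric `d_n(x, y) = max_{0 ≤ j < n} d(T^j x, T^j y)`
(for `n ≥ 1`). -/
def bowenBall (T : X → X) (n : ℕ) (x : X) (ε : ℝ) : Set X :=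
  {y | ∀ j < n, dist (T^[j] x) (T^[j] y) < ε}

/-- An at most countable collection `R` of Bowen balls `B_n(x, ε)`, each encoded by the pair
`(x, n)` with `n ≥ 1`, that covers `Z` and satisfies `n(R) ≥ N`. -/
def IsBowenCover (T : X → X) (Z : Set X) (ε : ℝ) (N : ℕ) (R : Set (X × ℕ)) : Prop :=
  R.Countable ∧ (∀ p ∈ R, 1 ≤ p.2 ∧ N ≤ p.2) ∧ Z ⊆ ⋃ p ∈ R, bowenBall T p.2 p.1 ε

/-- `H^s_N(Z, ε) = inf_R ∑ exp(-s n_i)`. -/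
def bowenPreMeasure (T : X → X) (Z : Set X) (ε : ℝ) (s : ℝ≥0) (N : ℕ) : ℝ≥0∞ :=
  ⨅ (R : Set (X × ℕ)) (_ : IsBowenCover T Z ε N R),
    ∑' p : R, ENNReal.ofReal (Real.exp (-(s : ℝ) * ((p : X × ℕ).2 : ℝ)))

/-- `H^s(Z, ε) = lim_N H^s_N(Z, ε)`; the limit is a supremum, because `H^s_N` is non-decreasing
in `N`. -/
def bowenMeasure (T : X → X) (Z : Set X) (ε : ℝ) (s : ℝ≥0) : ℝ≥0∞ :=
  ⨆ N : ℕ, bowenPreMeasure T Z ε s N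

/-- The critical value `h_top(Z, ε)` of `s ≥ 0`: `H^s(Z, ε)` vanishes for all larger `s` and is
infinite for all smaller `s`. It is `∞` if `H^s(Z, ε)` does not vanish for any `s`. -/
def topEntropyAt (T : X → X) (Z : Set X) (ε : ℝ) : ℝ≥0∞ :=
  ⨅ (s : ℝ≥0) (_ : bowenMeasure T Z ε s = 0), (s : ℝ≥0∞)

/-- Bowen's topological entropy `h_top(Z) = lim_{ε → 0} h_top(Z, ε)`; the limit is a supremum,
because `h_top(Z, ε)` is non-increasing in `ε`. -/
def topEntropy (T : X → X) (Z : Set X) : ℝ≥0∞ :=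
  ⨆ (ε : ℝ) (_ : 0 < ε), topEntropyAt T Z ε

end Topological

/-! ### Invariant measures and measure-theoretic entropy -/

section MeasureTheoretic

variable {X : Type*} [MeasurableSpace X]

/-- The set of `T`-invariant probability measures. -/
def invariantMeasures (T : X → X) : Set (Measure X) :=
  {μ | IsProbabilityMeasure μ ∧ MeasurePreserving T μ μ}

/-- A finite measurable partition is given by its label map `ξ : X → Fin k`. This is the Shannon
entropy of the joined partition `⋁_{i < n} T^{-i} ξ`, whose atoms are indexed by the words `w` of
length `n`. -/
def joinEntropy (T : X → X) (μ : Measure X) {k : ℕ} (ξ : X → Fin k) (n : ℕ) : ℝ :=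
  ∑ w : Fin n → Fin k, Real.negMulLog (μ.real {x | ∀ i : Fin n, ξ (T^[i] x) = w i})

/-- The entropy of `T` with respect to the partition `ξ`: the limit (it exists for invariant `μ`)
of `1/n` times the entropy of `⋁_{i < n} T^{-i} ξ`. -/
def partitionEntropy (T : X → X) (μ : Measure X) {k : ℕ} (ξ : X → Fin k) : ℝ≥0∞ :=
  limsup (fun n : ℕ => ENNReal.ofReal (joinEntropy T μ ξ n / n)) atTop

/-- The Kolmogorov–Sinai entropy `h_μ`: the supremum over all finite measurable partitions. -/
def measureEntropy (T : X → X) (μ : Measure X) : ℝ≥0∞ :=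
  ⨆ (k : ℕ) (ξ : X → Fin k) (_ : Measurable ξ), partitionEntropy T μ ξ

/-- The empirical measure `(1/n) ∑_{j < n} δ_{T^j x}`. -/
def empiricalMeasure (T : X → X) (n : ℕ) (x : X) : Measure X :=
  (n : ℝ≥0∞)⁻¹ • ∑ j ∈ Finset.range n, Measure.dirac (T^[j] x)

end MeasureTheoretic

/-! ### Generic points, saturated systems and the sets of points under study -/

section Saturated

variable {X : Type*} [MetricSpace X] [MeasurableSpace X]

/-- The set `G_μ` of `μ`-generic points: the empirical measures converge weak-star to `μ`. -/
def genericPoints (T : X → X) (μ : Measure X) : Set X :=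
  {x | ∀ f : C(X, ℝ),
    Tendsto (fun n : ℕ => ∫ y, f y ∂(empiricalMeasure T n x)) atTop (𝓝 (∫ y, f y ∂μ))}

/-- The system is saturated: `h_top(G_μ) = h_μ` for each invariant probability measure `μ`. -/
def IsSaturated (T : X → X) : Prop :=
  ∀ μ ∈ invariantMeasures T, topEntropy T (genericPoints T μ) = measureEntropy T μ

/-- The set `S(a, b)` of points `x` with
`a_i ≤ liminf A_n Φ_i(x) ≤ limsup A_n Φ_i(x) ≤ b_i` for all `i`. -/
def averageSet {ι : Type*} (T : X → X) (Φ : ι → C(X, ℝ)) (a b : ι → ℝ) : Set X :=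
  {x | ∀ i, a i ≤ liminf (fun n : ℕ => birkhoffAverage ℝ T (Φ i) n x) atTop ∧
    limsup (fun n : ℕ => birkhoffAverage ℝ T (Φ i) n x) atTop ≤ b i}

/-- The invariant probability measures `μ` with `a_i ≤ ∫ Φ_i dμ ≤ b_i` for all `i`. -/
def measureSet {ι : Type*} (T : X → X) (Φ : ι → C(X, ℝ)) (a b : ι → ℝ) : Set (Measure X) :=
  {μ | μ ∈ invariantMeasures T ∧ ∀ i, a i ≤ ∫ x, Φ i x ∂μ ∧ ∫ x, Φ i x ∂μ ≤ b i}

end Saturated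

end SaturatedSystem

end

/-!
If the code lengths `ℓ` on a finite alphabet satisfy Kraft's inequality `∑ exp (-ℓ) ≤ 1`, then for
each `N` at most `exp L` words of `N` letters have total length at most `L`. Take a fine partition
whose atoms have `μ`-null boundary and a code on its words of length `m` with mean length below
`m c` under `μ`, which exists for some `m` as soon as `h_μ < c`. The mean length is continuous at
`μ`, so the orbit segments of length `n` with empirical measure close to `μ` are coded by at most
`C exp (n c)` words, and their starting points lie in that many Bowen balls. Hence `H^s` vanishes,
for `s > h_μ`, on the set of points whose empirical measures visit a suitable neighbourhood of `μ`
infinitely often. The space of probability measures is second countable and `H^s` is countably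
subadditive, which gives Bowen's bound: the points with an empirical limit measure of entropy at
most `t` form a set of topological entropy at most `t`.

For `x ∈ S(a, b)` every empirical limit measure belongs to `M(a, b)`, and conversely
`G_μ ⊆ S(a, b)` for `μ ∈ M(a, b)`, so the lower bound is saturation.
-/

namespace SaturatedSystem

section BowenEntropy

variable {X : Type*} [MetricSpace X] {T : X → X} {Z : Set X} {ε : ℝ} {s : ℝ≥0}

lemma bowenPreMeasure_mono {Z' : Set X} (hZ : Z ⊆ Z') (ε : ℝ) (s : ℝ≥0) (N : ℕ) :
    bowenPreMeasure T Z ε s N ≤ bowenPreMeasure T Z' ε s N :=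
  le_iInf₂ fun R hR => iInf₂_le R ⟨hR.1, hR.2.1, hZ.trans hR.2.2⟩

lemma bowenMeasure_mono {Z' : Set X} (hZ : Z ⊆ Z') (ε : ℝ) (s : ℝ≥0) :
    bowenMeasure T Z ε s ≤ bowenMeasure T Z' ε s :=
  iSup_mono fun N => bowenPreMeasure_mono hZ ε s N

lemma topEntropy_mono {Z' : Set X} (hZ : Z ⊆ Z') : topEntropy T Z ≤ topEntropy T Z' :=
  iSup₂_mono fun ε _ => iInf₂_mono' fun s hs =>
    ⟨s, le_antisymm ((bowenMeasure_mono hZ ε s).trans hs.le) bot_le, le_rfl⟩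

lemma monotone_bowenPreMeasure : Monotone (bowenPreMeasure T Z ε s) := fun _ _ hMN =>
  le_iInf₂ fun R hR => iInf₂_le R ⟨hR.1, fun p hp => (hR.2.1 p hp).imp_right hMN.trans, hR.2.2⟩

lemma bowenPreMeasure_iUnion_le {κ : Type*} [Countable κ] (Z : κ → Set X) (ε : ℝ) (s : ℝ≥0)
    (N : ℕ) :
    bowenPreMeasure T (⋃ i, Z i) ε s N ≤ ∑' i, bowenPreMeasure T (Z i) ε s N := by
  refine ENNReal.le_of_forall_pos_le_add fun δ hδ hfin => ?_
  obtain ⟨δ', hδ', hsum⟩ := ENNReal.exists_pos_sum_of_countable' (ENNReal.coe_pos.2 hδ).ne' κ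
  have hnear : ∀ i, ∃ R, IsBowenCover T (Z i) ε N R ∧
      ∑' p : R, ENNReal.ofReal (Real.exp (-(s : ℝ) * ((p : X × ℕ).2 : ℝ))) <
        bowenPreMeasure T (Z i) ε s N + δ' i := fun i => by
    have hlt : bowenPreMeasure T (Z i) ε s N < bowenPreMeasure T (Z i) ε s N + δ' i :=
      ENNReal.lt_add_right (ENNReal.ne_top_of_tsum_ne_top hfin.ne i) (hδ' i).ne'
    conv_lhs at hlt => rw [bowenPreMeasure]
    simpa only [iInf_lt_iff, exists_prop] using hlt
  choose R hcover hR using hnear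
  have hunion : IsBowenCover T (⋃ i, Z i) ε N (⋃ i, R i) := by
    refine ⟨Set.countable_iUnion fun i => (hcover i).1, fun p hp => ?_, ?_⟩
    · obtain ⟨i, hi⟩ := Set.mem_iUnion.1 hp
      exact (hcover i).2.1 p hi
    · rw [Set.biUnion_iUnion]
      exact Set.iUnion_mono fun i => (hcover i).2.2
  calc bowenPreMeasure T (⋃ i, Z i) ε s N
      ≤ ∑' p : ⋃ i, R i, ENNReal.ofReal (Real.exp (-(s : ℝ) * ((p : X × ℕ).2 : ℝ))) :=
        iInf₂_le _ hunion
    _ ≤ ∑' i, ∑' p : R i, ENNReal.ofReal (Real.exp (-(s : ℝ) * ((p : X × ℕ).2 : ℝ))) :=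
        ENNReal.tsum_iUnion_le_tsum
          (fun p : X × ℕ => ENNReal.ofReal (Real.exp (-(s : ℝ) * (p.2 : ℝ)))) R
    _ ≤ ∑' i, (bowenPreMeasure T (Z i) ε s N + δ' i) := ENNReal.tsum_le_tsum fun i => (hR i).le
    _ = ∑' i, bowenPreMeasure T (Z i) ε s N + ∑' i, δ' i := ENNReal.tsum_add
    _ ≤ ∑' i, bowenPreMeasure T (Z i) ε s N + δ := by gcongr

lemma bowenMeasure_iUnion_le {κ : Type*} [Countable κ] (Z : κ → Set X) (ε : ℝ) (s : ℝ≥0) :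
    bowenMeasure T (⋃ i, Z i) ε s ≤ ∑' i, bowenMeasure T (Z i) ε s :=
  iSup_le fun N => (bowenPreMeasure_iUnion_le Z ε s N).trans <|
    ENNReal.tsum_le_tsum fun i => le_iSup (bowenPreMeasure T (Z i) ε s) N

lemma topEntropy_le_of_forall_bowenMeasure_eq_zero {t : ℝ≥0∞}
    (h : ∀ s : ℝ≥0, t < s → ∀ ε > 0, bowenMeasure T Z ε s = 0) : topEntropy T Z ≤ t := by
  refine le_of_forall_gt_imp_ge_of_dense fun u hu => ?_
  obtain ⟨s, hts, hsu⟩ := ENNReal.lt_iff_exists_nnreal_btwn.1 hu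
  exact iSup₂_le fun ε hε => (iInf₂_le s (h s hts ε hε)).trans hsu.le

lemma bowenPreMeasure_le_tsum_card {N : ℕ} (hN : 1 ≤ N) (F : ℕ → Finset X)
    (hZ : ∀ x ∈ Z, ∃ n ≥ N, ∃ y ∈ F n, x ∈ bowenBall T n y ε) :
    bowenPreMeasure T Z ε s N ≤
      ∑' k, (F (k + N)).card * ENNReal.ofReal (Real.exp (-(s : ℝ) * (k + N : ℕ))) := by
  let R : ℕ → Finset (X × ℕ) := fun k => F (k + N) ×ˢ {k + N}
  have hR : ∀ {k p}, p ∈ R k ↔ p.1 ∈ F (k + N) ∧ p.2 = k + N := by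
    simp [R, eq_comm]
  have hcover : IsBowenCover T Z ε N (⋃ k, (R k : Set (X × ℕ))) := by
    refine ⟨Set.countable_iUnion fun k => (R k).countable_toSet, fun p hp => ?_, fun x hx => ?_⟩
    · obtain ⟨k, hk⟩ := Set.mem_iUnion.1 hp
      have := (hR.1 hk).2
      omega
    · obtain ⟨n, hn, y, hy, hxy⟩ := hZ x hx
      obtain ⟨k, rfl⟩ := Nat.exists_eq_add_of_le' hn
      exact Set.mem_biUnion (x := (y, k + N)) (Set.mem_iUnion.2 ⟨k, hR.2 ⟨hy, rfl⟩⟩) hxy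
  let weight : X × ℕ → ℝ≥0∞ := fun p => ENNReal.ofReal (Real.exp (-(s : ℝ) * (p.2 : ℝ)))
  calc bowenPreMeasure T Z ε s N
      ≤ ∑' p : ⋃ k, (R k : Set (X × ℕ)), weight p := iInf₂_le _ hcover
    _ ≤ ∑' k, ∑' p : R k, weight p := ENNReal.tsum_iUnion_le_tsum weight _
    _ = ∑' k, (F (k + N)).card * ENNReal.ofReal (Real.exp (-(s : ℝ) * (k + N : ℕ))) := by
        congr with k
        rw [Finset.tsum_subtype (R k) weight, Finset.sum_product]
        simp only [weight, Finset.sum_singleton, Finset.sum_const, nsmul_eq_mul]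

lemma bowenMeasure_eq_zero_of_tsum_card_ne_top (F : ℕ → Finset X)
    (hsum : ∑' n, (F n).card * ENNReal.ofReal (Real.exp (-(s : ℝ) * n)) ≠ ∞)
    (hZ : ∀ x ∈ Z, ∃ᶠ n in atTop, ∃ y ∈ F n, x ∈ bowenBall T n y ε) :
    bowenMeasure T Z ε s = 0 := by
  refine ENNReal.iSup_eq_zero.2 fun N => le_antisymm ?_ bot_le
  refine ge_of_tendsto (ENNReal.tendsto_sum_nat_add _ hsum) ?_
  filter_upwards [eventually_ge_atTop N, eventually_ge_atTop 1] with M hNM hM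
  exact (monotone_bowenPreMeasure hNM).trans <|
    bowenPreMeasure_le_tsum_card hM F fun x hx => frequently_atTop.1 (hZ x hx) M

lemma bowenMeasure_eq_zero_of_card_le {C c : ℝ} (hcs : c < s) (F : ℕ → Finset X)
    (hF : ∀ n, ((F n).card : ℝ) ≤ C * Real.exp (n * c))
    (hZ : ∀ x ∈ Z, ∃ᶠ n in atTop, ∃ y ∈ F n, x ∈ bowenBall T n y ε) :
    bowenMeasure T Z ε s = 0 := by
  have hgeom : Summable fun n : ℕ => C * Real.exp (n * (c - s)) :=
    (Real.summable_exp_nat_mul_iff.2 (sub_neg.2 hcs)).mul_left C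
  refine bowenMeasure_eq_zero_of_tsum_card_ne_top F
    (ne_top_of_le_ne_top hgeom.tsum_ofReal_ne_top (ENNReal.tsum_le_tsum fun n => ?_)) hZ
  rw [← ENNReal.ofReal_natCast, ← ENNReal.ofReal_mul (Nat.cast_nonneg _)]
  refine ENNReal.ofReal_le_ofReal ?_
  calc ((F n).card : ℝ) * Real.exp (-(s : ℝ) * n)
      ≤ C * Real.exp (n * c) * Real.exp (-(s : ℝ) * n) := by gcongr; exact hF n
    _ = C * Real.exp (n * (c - s)) := by rw [mul_assoc, ← Real.exp_add]; ring_nf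

end BowenEntropy

section Coding

lemma nonneg_of_sum_exp_neg_le_one {A : Type*} [Fintype A] {ℓ : A → ℝ}
    (hℓ : ∑ a, Real.exp (-ℓ a) ≤ 1) (a : A) : 0 ≤ ℓ a := by
  have : Real.exp (-ℓ a) ≤ 1 := (Finset.single_le_sum (f := fun a => Real.exp (-ℓ a))
    (fun _ _ => (Real.exp_pos _).le) (Finset.mem_univ a)).trans hℓ
  simpa using this

/-- Kraft's inequality for the `N`-fold concatenation of a code with lengths `ℓ`, with side
information in `B`. -/
lemma sum_exp_neg_sum_le_card {Y A B : Type*} [Fintype A] [Fintype B] {ℓ : A → ℝ}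
    (hℓ : ∑ a, Real.exp (-ℓ a) ≤ 1) {N : ℕ} {side : Y → B} {word : Y → Fin N → A} {F : Finset Y}
    (hF : Set.InjOn (fun y => (side y, word y)) F) :
    ∑ y ∈ F, Real.exp (-∑ i, ℓ (word y i)) ≤ Fintype.card B := by
  classical
  let weight : B × (Fin N → A) → ℝ := fun p => ∏ i, Real.exp (-ℓ (p.2 i))
  calc ∑ y ∈ F, Real.exp (-∑ i, ℓ (word y i))
      = ∑ y ∈ F, weight (side y, word y) := by
        simp only [weight, ← Real.exp_sum, Finset.sum_neg_distrib]
    _ = ∑ p ∈ F.image fun y => (side y, word y), weight p := (Finset.sum_image hF).symm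
    _ ≤ ∑ p, weight p := Finset.sum_le_univ_sum_of_nonneg fun p =>
        Finset.prod_nonneg fun i _ => (Real.exp_pos _).le
    _ = Fintype.card B * (∑ a, Real.exp (-ℓ a)) ^ N := by
        simp only [weight, Fintype.sum_prod_type, Fintype.sum_pow, Finset.sum_const,
          Finset.card_univ, nsmul_eq_mul]
    _ ≤ Fintype.card B := mul_le_of_le_one_right (Nat.cast_nonneg _) <|
        pow_le_one₀ (Finset.sum_nonneg fun a _ => (Real.exp_pos _).le) hℓ

/-- The Shannon lengths `-log p a` are infinite where `p` vanishes, so `p` is first mixed with a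
small multiple of the uniform distribution. -/
lemma exists_sum_exp_neg_le_one_sum_mul_lt {A : Type*} [Fintype A] {p : A → ℝ}
    (hp : ∀ a, 0 ≤ p a) (hp1 : ∑ a, p a = 1) {d : ℝ} (hd : ∑ a, Real.negMulLog (p a) < d) :
    ∃ ℓ : A → ℝ, ∑ a, Real.exp (-ℓ a) ≤ 1 ∧ ∑ a, p a * ℓ a < d := by
  let q : ℝ → A → ℝ := fun η a => (p a + η) / (1 + η * Fintype.card A)
  have hlim : Tendsto (fun η => ∑ a, p a * -Real.log (q η a)) (𝓝[>] 0)
      (𝓝 (∑ a, Real.negMulLog (p a))) := by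
    refine tendsto_finsetSum _ fun a _ => tendsto_nhdsWithin_of_tendsto_nhds ?_
    rcases (hp a).eq_or_lt with hpa | hpa
    · simp [← hpa]
    · have hq0 : q 0 a = p a := by simp [q]
      have hcont : ContinuousAt (fun η => p a * -Real.log (q η a)) 0 := by
        have hq : ContinuousAt (fun η => q η a) 0 :=
          ContinuousAt.div (by fun_prop) (by fun_prop) (by simp)
        exact continuousAt_const.mul (hq.log (hq0.trans_ne hpa.ne')).neg
      simpa only [ContinuousAt, hq0, Real.negMulLog, neg_mul, mul_neg] using hcont
  obtain ⟨η, hlt, hη⟩ := ((hlim.eventually_lt_const hd).and self_mem_nhdsWithin).exists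
  have hη : 0 < η := hη
  have hden : 0 < 1 + η * Fintype.card A := by positivity
  have hq : ∀ a, 0 < q η a := fun a => div_pos (add_pos_of_nonneg_of_pos (hp a) hη) hden
  refine ⟨fun a => -Real.log (q η a), le_of_eq ?_, hlt⟩
  simp only [neg_neg, Real.exp_log (hq _)]
  rw [← Finset.sum_div, Finset.sum_add_distrib, hp1, Finset.sum_const, Finset.card_univ,
    nsmul_eq_mul, mul_comm, div_self hden.ne']

end Coding

section Words

variable {X E : Type*} {T : X → X} {ξ : X → E}

/-- The word of length `m` that the labelling `ξ` reads along the orbit of `x`; the fibres of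
`orbitWord T ξ m` are the atoms of `⋁_{i < m} T^{-i} ξ`. -/
def orbitWord (T : X → X) (ξ : X → E) (m : ℕ) (x : X) : Fin m → E :=
  fun i => ξ (T^[i] x)

lemma birkhoffSum_mul {M : Type*} [AddCommMonoid M] (T : X → X) (g : X → M) (m N : ℕ) (x : X) :
    birkhoffSum T g (m * N) x = ∑ r ∈ Finset.range m, birkhoffSum T^[m] g N (T^[r] x) := by
  induction N with
  | zero => simp
  | succ N ih =>
    simp only [Nat.mul_succ, birkhoffSum_add, ih, birkhoffSum_succ, Finset.sum_add_distrib]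
    simp only [birkhoffSum, ← Function.iterate_mul, ← Function.iterate_add_apply, add_comm]

lemma orbitWord_eq_of_blocks {m n r : ℕ} (hr : r < m) {x y : X}
    (hprefix : orbitWord T ξ m x = orbitWord T ξ m y)
    (hblocks : ∀ i ≤ n / m,
      orbitWord T ξ m ((T^[m])^[i] (T^[r] x)) = orbitWord T ξ m ((T^[m])^[i] (T^[r] y))) :
    orbitWord T ξ n x = orbitWord T ξ n y := by
  funext ⟨l, hl⟩
  by_cases hlr : l < r
  · exact congrFun hprefix ⟨l, hlr.trans hr⟩
  · have hposition : (l - r) % m + (m * ((l - r) / m) + r) = l := by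
      have := Nat.mod_add_div (l - r) m
      omega
    have hletter := congrFun (hblocks _ (Nat.div_le_div_right ((Nat.sub_le l r).trans hl.le)))
      ⟨(l - r) % m, Nat.mod_lt _ (Nat.zero_lt_of_lt hr)⟩
    simpa only [orbitWord, ← Function.iterate_mul, ← Function.iterate_add_apply, hposition]
      using hletter

lemma exists_finset_injOn_orbitWord [Finite E] (T : X → X) (ξ : X → E) (Z : Set X) (n : ℕ) :
    ∃ F : Finset X, (F : Set X) ⊆ Z ∧ Set.InjOn (orbitWord T ξ n) F ∧
      ∀ x ∈ Z, ∃ y ∈ F, orbitWord T ξ n y = orbitWord T ξ n x := by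
  obtain ⟨u, huZ, hbij⟩ := Set.exists_subset_bijOn Z (orbitWord T ξ n)
  lift u to Finset X using Set.Finite.of_finite_image (Set.toFinite _) hbij.injOn
  exact ⟨u, huZ, hbij.injOn, fun x hx => hbij.surjOn (Set.mem_image_of_mem _ hx)⟩

variable [Fintype E] {m n : ℕ} {ℓ : (Fin m → E) → ℝ} {F : Finset X}

lemma sum_exp_neg_birkhoffSum_le {r : ℕ} (hr : r < m) (hℓ : ∑ w, Real.exp (-ℓ w) ≤ 1)
    (hF : Set.InjOn (orbitWord T ξ n) F) :
    ∑ x ∈ F, Real.exp (-birkhoffSum T^[m] (ℓ ∘ orbitWord T ξ m) (n / m) (T^[r] x)) ≤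
      Fintype.card ((Fin m → E) × (Fin m → E)) := by
  let block : ℕ → X → Fin m → E := fun i x => orbitWord T ξ m ((T^[m])^[i] (T^[r] x))
  have hinj : Set.InjOn (fun x => ((orbitWord T ξ m x, block (n / m) x),
      fun i : Fin (n / m) => block i x)) F := by
    intro x hx y hy hxy
    simp only [Prod.mk.injEq] at hxy
    obtain ⟨⟨hprefix, hlast⟩, hblocks⟩ := hxy
    refine hF hx hy (orbitWord_eq_of_blocks hr hprefix fun i hi => ?_)
    rcases hi.lt_or_eq with hi | rfl
    · exact congrFun hblocks ⟨i, hi⟩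
    · exact hlast
  simpa only [birkhoffSum, Finset.sum_range, Function.comp_apply] using
    sum_exp_neg_sum_le_card hℓ hinj

/-- The average of `ℓ` over the `n` subwords of length `m` is an average over the `m` ways to cut
the orbit segment into blocks, so one of the cuts has total code length at most `n c`. -/
lemma card_le_of_birkhoffSum_le (hm : 0 < m) (hℓ : ∑ w, Real.exp (-ℓ w) ≤ 1) {c : ℝ}
    (hF : Set.InjOn (orbitWord T ξ n) F)
    (hc : ∀ x ∈ F, birkhoffSum T (ℓ ∘ orbitWord T ξ m) n x ≤ n * (m * c)) :
    (F.card : ℝ) ≤ m * Fintype.card ((Fin m → E) × (Fin m → E)) * Real.exp (n * c) := by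
  let len : ℕ → X → ℝ := fun r x =>
    birkhoffSum T^[m] (ℓ ∘ orbitWord T ξ m) (n / m) (T^[r] x)
  have hcut : ∀ x ∈ F, ∃ r ∈ Finset.range m, len r x ≤ n * c := fun x hx => by
    refine Finset.exists_le_of_sum_le (Finset.nonempty_range_iff.2 hm.ne') ?_
    calc ∑ r ∈ Finset.range m, len r x
        = birkhoffSum T (ℓ ∘ orbitWord T ξ m) (m * (n / m)) x := (birkhoffSum_mul ..).symm
      _ ≤ birkhoffSum T (ℓ ∘ orbitWord T ξ m) n x :=
          Finset.sum_le_sum_of_subset_of_nonneg (Finset.range_mono (Nat.mul_div_le n m))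
            fun _ _ _ => nonneg_of_sum_exp_neg_le_one hℓ _
      _ ≤ n * (m * c) := hc x hx
      _ = ∑ _r ∈ Finset.range m, n * c := by
          rw [Finset.sum_const, Finset.card_range, nsmul_eq_mul]; ring
  have hexp : ∀ x ∈ F, Real.exp (-(n * c)) ≤ ∑ r ∈ Finset.range m, Real.exp (-len r x) := by
    intro x hx
    obtain ⟨r, hr, hrx⟩ := hcut x hx
    exact (Real.exp_le_exp.2 (neg_le_neg hrx)).trans <|
      Finset.single_le_sum (f := fun r => Real.exp (-len r x)) (fun _ _ => (Real.exp_pos _).le) hr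
  have hsum : F.card * Real.exp (-(n * c)) ≤ m * Fintype.card ((Fin m → E) × (Fin m → E)) :=
    calc F.card * Real.exp (-(n * c)) = ∑ _x ∈ F, Real.exp (-(n * c)) := by
          rw [Finset.sum_const, nsmul_eq_mul]
      _ ≤ ∑ x ∈ F, ∑ r ∈ Finset.range m, Real.exp (-len r x) := Finset.sum_le_sum hexp
      _ = ∑ r ∈ Finset.range m, ∑ x ∈ F, Real.exp (-len r x) := Finset.sum_comm
      _ ≤ ∑ _r ∈ Finset.range m, (Fintype.card ((Fin m → E) × (Fin m → E)) : ℝ) :=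
          Finset.sum_le_sum fun r hr => sum_exp_neg_birkhoffSum_le (Finset.mem_range.1 hr) hℓ hF
      _ = m * Fintype.card ((Fin m → E) × (Fin m → E)) := by
          rw [Finset.sum_const, Finset.card_range, nsmul_eq_mul]
  rwa [Real.exp_neg, ← div_eq_mul_inv, div_le_iff₀ (Real.exp_pos _)] at hsum

lemma exists_finset_bowenBall_of_birkhoffSum_le [MetricSpace X] {ε : ℝ}
    (hξ : ∀ x y, ξ x = ξ y → dist x y < ε) (hm : 0 < m) (hℓ : ∑ w, Real.exp (-ℓ w) ≤ 1) (c : ℝ)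
    (n : ℕ) :
    ∃ F : Finset X,
      (F.card : ℝ) ≤ m * Fintype.card ((Fin m → E) × (Fin m → E)) * Real.exp (n * c) ∧
      ∀ x, birkhoffSum T (ℓ ∘ orbitWord T ξ m) n x ≤ n * (m * c) →
        ∃ y ∈ F, x ∈ bowenBall T n y ε := by
  obtain ⟨F, hFZ, hinj, hF⟩ := exists_finset_injOn_orbitWord T ξ
    {x | birkhoffSum T (ℓ ∘ orbitWord T ξ m) n x ≤ n * (m * c)} n
  refine ⟨F, card_le_of_birkhoffSum_le hm hℓ hinj hFZ, fun x hx => ?_⟩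
  obtain ⟨y, hy, hyx⟩ := hF x hx
  exact ⟨y, hy, fun j hj => hξ _ _ (congrFun hyx ⟨j, hj⟩)⟩

end Words

section Partitions

variable {X E : Type*} [MeasurableSpace X] {T : X → X} {ξ : X → E} {μ : Measure X}

lemma measurable_orbitWord [MeasurableSpace E] (hT : Measurable T) (hξ : Measurable ξ) (m : ℕ) :
    Measurable (orbitWord T ξ m) :=
  measurable_pi_lambda _ fun i => hξ.comp (hT.iterate i)

lemma joinEntropy_eq_sum_orbitWord (T : X → X) (μ : Measure X) {k : ℕ} (ξ : X → Fin k) (m : ℕ) :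
    joinEntropy T μ ξ m = ∑ w, Real.negMulLog (μ.real (orbitWord T ξ m ⁻¹' {w})) := by
  simp only [joinEntropy, orbitWord, Set.preimage, Set.mem_singleton_iff, funext_iff]

lemma exists_joinEntropy_lt {c : ℝ≥0} (hc : measureEntropy T μ < c) {k : ℕ} {ξ : X → Fin k}
    (hξ : Measurable ξ) : ∃ m : ℕ, 0 < m ∧ joinEntropy T μ ξ m < m * c := by
  have hle : partitionEntropy T μ ξ ≤ measureEntropy T μ :=
    le_iSup_of_le k (le_iSup₂_of_le ξ hξ le_rfl)
  obtain ⟨m, hlt, hm⟩ :=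
    ((eventually_lt_of_limsup_lt (hle.trans_lt hc)).and (eventually_gt_atTop 0)).exists
  rw [← ENNReal.ofReal_coe_nnreal, ENNReal.ofReal_lt_ofReal_iff', div_lt_iff₀ (Nat.cast_pos.2 hm),
    mul_comm] at hlt
  exact ⟨m, hm, hlt.1⟩

lemma integral_comp_eq_sum_preimage_singleton {A : Type*} [Fintype A] [MeasurableSpace A]
    [DiscreteMeasurableSpace A] [IsFiniteMeasure μ] {g : X → A} (hg : Measurable g) (ℓ : A → ℝ) :
    ∫ x, ℓ (g x) ∂μ = ∑ a, μ.real (g ⁻¹' {a}) * ℓ a := by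
  rw [← integral_map hg.aemeasurable Measurable.of_discrete.aestronglyMeasurable,
    integral_fintype .of_finite]
  simp only [map_measureReal_apply hg (.of_discrete), smul_eq_mul]

section Topology

variable [TopologicalSpace X]

lemma null_frontier_preimage (hT : Continuous T)
    (hμ : MeasurePreserving T μ μ) {A : Set X} (hA : μ (frontier A) = 0) :
    μ (frontier (T ⁻¹' A)) = 0 :=
  measure_mono_null (hT.frontier_preimage_subset A) (hμ.quasiMeasurePreserving.preimage_null hA)

lemma null_frontier_biInter {κ : Type*} (s : Finset κ) {A : κ → Set X}
    (hA : ∀ i ∈ s, μ (frontier (A i)) = 0) : μ (frontier (⋂ i ∈ s, A i)) = 0 := by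
  classical
  induction s using Finset.induction_on with
  | empty => simp
  | insert i s _ ih =>
    rw [Finset.set_biInter_insert]
    exact null_frontier_inter (hA i (Finset.mem_insert_self _ _))
      (ih fun j hj => hA j (Finset.mem_insert_of_mem hj))

lemma null_frontier_preimage_singleton_pi {κ : Type*} [Finite κ] {f : X → κ → E}
    (hf : ∀ i a, μ (frontier ((f · i) ⁻¹' {a})) = 0) (w : κ → E) :
    μ (frontier (f ⁻¹' {w})) = 0 := by
  cases nonempty_fintype κ
  have hfibre : f ⁻¹' {w} = ⋂ i ∈ Finset.univ, (f · i) ⁻¹' {w i} := by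
    ext x
    simp [funext_iff]
  rw [hfibre]
  exact null_frontier_biInter _ fun i _ => hf i (w i)

lemma null_frontier_preimage_orbitWord (hT : Continuous T)
    (hμ : MeasurePreserving T μ μ) (hξ : ∀ a, μ (frontier (ξ ⁻¹' {a})) = 0) {m : ℕ}
    (w : Fin m → E) : μ (frontier (orbitWord T ξ m ⁻¹' {w})) = 0 :=
  null_frontier_preimage_singleton_pi (f := orbitWord T ξ m)
    (fun i a => null_frontier_preimage (A := ξ ⁻¹' {a}) (hT.iterate i) (hμ.iterate i) (hξ a)) w

lemma continuousAt_integral_comp_of_null_frontier [HasOuterApproxClosed X] [BorelSpace X]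
    {A : Type*} [Finite A] [MeasurableSpace A] [DiscreteMeasurableSpace A] {g : X → A}
    (hg : Measurable g) (ℓ : A → ℝ) {μ : ProbabilityMeasure X}
    (hnull : ∀ a, (μ : Measure X) (frontier (g ⁻¹' {a})) = 0) :
    ContinuousAt (fun ν : ProbabilityMeasure X => ∫ x, ℓ (g x) ∂(ν : Measure X)) μ := by
  cases nonempty_fintype A
  simp only [integral_comp_eq_sum_preimage_singleton hg]
  refine tendsto_finsetSum _ fun a _ => Tendsto.mul_const _ ?_
  exact (ENNReal.tendsto_toReal (measure_ne_top _ _)).comp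
    (ProbabilityMeasure.tendsto_measure_of_null_frontier_of_tendsto' tendsto_id (hnull a))

end Topology

/-- The labels record which balls of a finite cover by balls with null boundary contain a point. -/
lemma exists_partition_null_frontier {X : Type*} [PseudoMetricSpace X] [CompactSpace X]
    [MeasurableSpace X] [OpensMeasurableSpace X] (μ : Measure X) [SFinite μ] {ε : ℝ}
    (hε : 0 < ε) :
    ∃ (k : ℕ) (ξ : X → Fin k), Measurable ξ ∧ (∀ x y, ξ x = ξ y → dist x y < ε) ∧
      ∀ i, μ (frontier (ξ ⁻¹' {i})) = 0 := by
  classical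
  have hradius : ∀ x : X, ∃ r ∈ Set.Ioo (0 : ℝ) (ε / 2), μ (frontier (Metric.ball x r)) = 0 :=
    fun x => by simpa using exists_null_frontier_thickening μ {x} (half_pos hε)
  choose r hr hnull using hradius
  obtain ⟨t, ht⟩ := CompactSpace.elim_nhds_subcover (fun x => Metric.ball x (r x))
    fun x => Metric.ball_mem_nhds x (hr x).1
  let label : X → t → Prop := fun x y => x ∈ Metric.ball (y : X) (r y)
  let e := Fintype.equivFin (t → Prop)
  have hlabel : Measurable label := measurable_pi_lambda _ fun y => measurableSet_ball.mem
  refine ⟨_, e ∘ label, Measurable.of_discrete.comp hlabel, fun x y hxy => ?_, fun i => ?_⟩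
  · obtain ⟨z, hz, hxz⟩ := Set.mem_iUnion₂.1 (ht.ge (Set.mem_univ x))
    have hyz : y ∈ Metric.ball z (r z) := (congrFun (e.injective hxy) ⟨z, hz⟩).mp hxz
    rw [Metric.mem_ball] at hxz hyz
    linarith [dist_triangle_right x y z, (hr z).2]
  · have hpre : e ∘ label ⁻¹' {i} = label ⁻¹' {e.symm i} := by
      ext x
      simp [Equiv.eq_symm_apply]
    rw [hpre]
    refine null_frontier_preimage_singleton_pi (fun y P => ?_) _
    by_cases hP : P
    · have hball : (label · y) ⁻¹' {P} = Metric.ball (y : X) (r y) := by ext; simp [label, hP]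
      rw [hball, hnull]
    · have hball : (label · y) ⁻¹' {P} = (Metric.ball (y : X) (r y))ᶜ := by
        ext; simp [label, hP]
      rw [hball, frontier_compl, hnull]

end Partitions

section EmpiricalMeasures

variable {X : Type*} [MeasurableSpace X]

lemma isProbabilityMeasure_empiricalMeasure (T : X → X) {n : ℕ} (hn : n ≠ 0) (x : X) :
    IsProbabilityMeasure (empiricalMeasure T n x) := by
  constructor
  simp [empiricalMeasure, ENNReal.inv_mul_cancel, hn]

lemma integral_empiricalMeasure [MeasurableSingletonClass X] (T : X → X) (f : X → ℝ) (n : ℕ)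
    (x : X) : ∫ y, f y ∂(empiricalMeasure T n x) = birkhoffAverage ℝ T f n x := by
  rw [empiricalMeasure, integral_smul_measure,
    integral_finsetSum_measure fun j _ => integrable_dirac (by simp)]
  simp [birkhoffAverage, birkhoffSum]

/-- The empirical measure as an element of the space of probability measures. There is no
empirical measure of order `0`; its place is taken by the point mass at `x`. -/
noncomputable def empiricalProbability (T : X → X) (n : ℕ) (x : X) : ProbabilityMeasure X :=
  if hn : n = 0 then ⟨Measure.dirac x, inferInstance⟩
  else ⟨empiricalMeasure T n x, isProbabilityMeasure_empiricalMeasure T hn x⟩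

lemma coe_empiricalProbability (T : X → X) {n : ℕ} (hn : n ≠ 0) (x : X) :
    (empiricalProbability T n x : Measure X) = empiricalMeasure T n x :=
  congrArg Subtype.val (dif_neg hn)

/-- The set `V_T(x)` of weak-star limit points of the empirical measures of `x`. -/
def empiricalLimits [TopologicalSpace X] [OpensMeasurableSpace X] (T : X → X) (x : X) :
    Set (ProbabilityMeasure X) :=
  {μ | MapClusterPt μ atTop fun n => empiricalProbability T n x}

end EmpiricalMeasures

section LimitPoints

lemma norm_birkhoffAverage_le {X E : Type*} [NormedAddCommGroup E] [NormedSpace ℝ E] {g : X → E}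
    {C : ℝ} (hg : ∀ x, ‖g x‖ ≤ C) (T : X → X) (n : ℕ) (x : X) :
    ‖birkhoffAverage ℝ T g n x‖ ≤ C := by
  have hsum : ‖birkhoffSum T g n x‖ ≤ n * C := by
    simpa [birkhoffSum] using norm_sum_le_of_le (Finset.range n) fun j _ => hg (T^[j] x)
  rw [birkhoffAverage, norm_smul, norm_inv, Real.norm_natCast]
  exact inv_mul_le_of_le_mul₀ (Nat.cast_nonneg _) ((norm_nonneg _).trans (hg x)) hsum

variable {X : Type*} [MetricSpace X] [CompactSpace X] [MeasurableSpace X] [BorelSpace X]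
  {T : X → X} {x : X} {μ : ProbabilityMeasure X}

lemma empiricalLimits_nonempty (T : X → X) (x : X) : (empiricalLimits T x).Nonempty :=
  exists_clusterPt_of_compactSpace _

lemma mapClusterPt_birkhoffAverage (hμ : μ ∈ empiricalLimits T x) (g : C(X, ℝ)) :
    MapClusterPt (∫ y, g y ∂(μ : Measure X)) atTop fun n => birkhoffAverage ℝ T g n x := by
  have hintegral := hμ.continuousAt_comp
    (ProbabilityMeasure.continuous_integral_continuousMap g).continuousAt
  refine mapClusterPt_iff_frequently.2 fun s hs => ?_
  refine ((mapClusterPt_iff_frequently.1 hintegral s hs).and_eventually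
    (eventually_ne_atTop 0)).mono ?_
  rintro n ⟨hmem, hn⟩
  rwa [Function.comp_apply, coe_empiricalProbability T hn, integral_empiricalMeasure] at hmem

lemma liminf_birkhoffAverage_le_integral (hμ : μ ∈ empiricalLimits T x) (g : C(X, ℝ)) :
    liminf (fun n => birkhoffAverage ℝ T g n x) atTop ≤ ∫ y, g y ∂(μ : Measure X) :=
  (mapClusterPt_birkhoffAverage hμ g).liminf_le <| isBoundedUnder_of
    ⟨_, fun n => (abs_le.1 (norm_birkhoffAverage_le g.norm_coe_le_norm T n x)).1⟩

lemma integral_le_limsup_birkhoffAverage (hμ : μ ∈ empiricalLimits T x) (g : C(X, ℝ)) :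
    ∫ y, g y ∂(μ : Measure X) ≤ limsup (fun n => birkhoffAverage ℝ T g n x) atTop :=
  (mapClusterPt_birkhoffAverage hμ g).le_limsup <| isBoundedUnder_of
    ⟨_, fun n => (abs_le.1 (norm_birkhoffAverage_le g.norm_coe_le_norm T n x)).2⟩

lemma integral_comp_eq_of_mem_empiricalLimits (hT : Continuous T) (hμ : μ ∈ empiricalLimits T x)
    (f : C(X, ℝ)) : ∫ y, f (T y) ∂(μ : Measure X) = ∫ y, f y ∂(μ : Measure X) := by
  let g : C(X, ℝ) := f.comp ⟨T, hT⟩ - f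
  have hg : birkhoffAverage ℝ T g = fun n x =>
      birkhoffAverage ℝ T f n (T x) - birkhoffAverage ℝ T f n x := by
    ext n x
    simp only [birkhoffAverage, birkhoffSum, g, ← smul_sub, ← Finset.sum_sub_distrib,
      ContinuousMap.sub_apply, ContinuousMap.comp_apply, ContinuousMap.coe_mk,
      ← Function.iterate_succ_apply, ← Function.iterate_succ_apply']
  have hzero : Tendsto (fun n => birkhoffAverage ℝ T g n x) atTop (𝓝 0) := by
    simpa only [hg] using tendsto_birkhoffAverage_apply_sub_birkhoffAverage' ℝ
      (isCompact_range f.continuous).isBounded T x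
  have hlimit : ∫ y, g y ∂(μ : Measure X) = 0 :=
    le_antisymm ((integral_le_limsup_birkhoffAverage hμ g).trans hzero.limsup_eq.le)
      (hzero.liminf_eq.ge.trans (liminf_birkhoffAverage_le_integral hμ g))
  have hint : ∀ h : C(X, ℝ), Integrable h (μ : Measure X) := fun h =>
    h.continuous.integrable_of_hasCompactSupport (HasCompactSupport.of_compactSpace h)
  exact sub_eq_zero.1 ((integral_sub (hint (f.comp ⟨T, hT⟩)) (hint f)).symm.trans hlimit)

lemma measurePreserving_of_mem_empiricalLimits (hT : Continuous T)
    (hμ : μ ∈ empiricalLimits T x) : MeasurePreserving T (μ : Measure X) μ := by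
  have := Measure.isProbabilityMeasure_map (μ := (μ : Measure X)) hT.aemeasurable
  refine ⟨hT.measurable, ext_of_forall_integral_eq_of_IsFiniteMeasure fun f => ?_⟩
  rw [integral_map hT.aemeasurable f.continuous.aestronglyMeasurable]
  exact integral_comp_eq_of_mem_empiricalLimits hT hμ f.toContinuousMap

variable {ι : Type*} {Φ : ι → C(X, ℝ)} {a b : ι → ℝ}

lemma coe_mem_measureSet_of_mem_empiricalLimits (hT : Continuous T)
    (hx : x ∈ averageSet T Φ a b) (hμ : μ ∈ empiricalLimits T x) :
    (μ : Measure X) ∈ measureSet T Φ a b :=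
  ⟨⟨inferInstance, measurePreserving_of_mem_empiricalLimits hT hμ⟩, fun i =>
    ⟨(hx i).1.trans (liminf_birkhoffAverage_le_integral hμ (Φ i)),
      (integral_le_limsup_birkhoffAverage hμ (Φ i)).trans (hx i).2⟩⟩

end LimitPoints

lemma genericPoints_subset_averageSet {X : Type*} [MetricSpace X] [MeasurableSpace X]
    [MeasurableSingletonClass X] {T : X → X} {ι : Type*} {Φ : ι → C(X, ℝ)} {a b : ι → ℝ}
    {μ : Measure X} (hμ : μ ∈ measureSet T Φ a b) :
    genericPoints T μ ⊆ averageSet T Φ a b := by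
  intro x hx i
  have hlim : Tendsto (fun n => birkhoffAverage ℝ T (Φ i) n x) atTop (𝓝 (∫ y, Φ i y ∂μ)) := by
    simpa only [integral_empiricalMeasure] using hx (Φ i)
  rw [hlim.liminf_eq, hlim.limsup_eq]
  exact hμ.2 i

section BowenUpperBound

variable {X : Type*} [MetricSpace X] [CompactSpace X] [MeasurableSpace X] [BorelSpace X]
  {T : X → X} {μ : ProbabilityMeasure X} {ε : ℝ}

lemma exists_nhds_finset_bowenBall (hT : Continuous T)
    (hμ : MeasurePreserving T (μ : Measure X) μ) {c : ℝ≥0}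
    (hc : measureEntropy T (μ : Measure X) < c) (hε : 0 < ε) :
    ∃ W ∈ 𝓝 μ, ∃ C : ℝ, ∀ n : ℕ, ∃ F : Finset X, (F.card : ℝ) ≤ C * Real.exp (n * c) ∧
      ∀ x, empiricalProbability T n x ∈ W → ∃ y ∈ F, x ∈ bowenBall T n y ε := by
  obtain ⟨k, ξ, hξ, hdiam, hnull⟩ := exists_partition_null_frontier (μ : Measure X) hε
  obtain ⟨m, hm, hentropy⟩ := exists_joinEntropy_lt hc hξ
  have hword : Measurable (orbitWord T ξ m) := measurable_orbitWord hT.measurable hξ m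
  have hone : ∑ w, (μ : Measure X).real (orbitWord T ξ m ⁻¹' {w}) = 1 := by
    simpa using sum_measureReal_preimage_singleton (μ := (μ : Measure X)) Finset.univ
      fun w _ => hword (measurableSet_singleton w)
  rw [joinEntropy_eq_sum_orbitWord] at hentropy
  obtain ⟨ℓ, hℓ, hlength⟩ := exists_sum_exp_neg_le_one_sum_mul_lt (fun _ => measureReal_nonneg)
    hone hentropy
  rw [← integral_comp_eq_sum_preimage_singleton hword] at hlength
  have hcont := continuousAt_integral_comp_of_null_frontier hword ℓ
    (null_frontier_preimage_orbitWord hT hμ hnull)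
  refine ⟨_, hcont.eventually_lt_const hlength,
    m * Fintype.card ((Fin m → Fin k) × (Fin m → Fin k)), fun n => ?_⟩
  obtain ⟨F, hcard, hF⟩ := exists_finset_bowenBall_of_birkhoffSum_le (T := T) hdiam hm hℓ c n
  refine ⟨F, hcard, fun x hx => hF x ?_⟩
  rcases eq_or_ne n 0 with rfl | hn
  · simp
  · have hmean : birkhoffAverage ℝ T (ℓ ∘ orbitWord T ξ m) n x < m * c := by
      rw [← integral_empiricalMeasure, ← coe_empiricalProbability T hn]
      exact hx
    rw [birkhoffAverage, smul_eq_mul, inv_mul_lt_iff₀ (by positivity)] at hmean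
    exact hmean.le

lemma exists_nhds_bowenMeasure_eq_zero (hT : Continuous T)
    (hμ : MeasurePreserving T (μ : Measure X) μ) {s : ℝ≥0}
    (hs : measureEntropy T (μ : Measure X) < s) (hε : 0 < ε) :
    ∃ W ∈ 𝓝 μ, bowenMeasure T {x | ∃ᶠ n in atTop, empiricalProbability T n x ∈ W} ε s = 0 := by
  obtain ⟨c, hc, hcs⟩ := ENNReal.lt_iff_exists_nnreal_btwn.1 hs
  obtain ⟨W, hW, C, hF⟩ := exists_nhds_finset_bowenBall hT hμ hc hε
  choose F hcard hF using hF
  exact ⟨W, hW, bowenMeasure_eq_zero_of_card_le (by exact_mod_cast hcs) F hcard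
    fun x hx => hx.mono fun n => hF n x⟩

theorem topEntropy_setOf_exists_empiricalLimits_le (hT : Continuous T) (t : ℝ≥0∞) :
    topEntropy T {x | ∃ μ ∈ empiricalLimits T x, measureEntropy T (μ : Measure X) ≤ t} ≤ t := by
  refine topEntropy_le_of_forall_bowenMeasure_eq_zero fun s hts ε hε => ?_
  let M : Set (ProbabilityMeasure X) :=
    {μ | MeasurePreserving T (μ : Measure X) μ ∧ measureEntropy T (μ : Measure X) ≤ t}
  have hlocal : ∀ μ ∈ M, ∃ W ∈ 𝓝 μ,
      bowenMeasure T {x | ∃ᶠ n in atTop, empiricalProbability T n x ∈ W} ε s = 0 :=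
    fun μ hμ => exists_nhds_bowenMeasure_eq_zero hT hμ.1 (hμ.2.trans_lt hts) hε
  choose! W hW hzero using hlocal
  obtain ⟨D, hDM, hD, hcover⟩ := TopologicalSpace.countable_cover_nhdsWithin
    fun μ hμ => mem_nhdsWithin_of_mem_nhds (interior_mem_nhds.2 (hW μ hμ))
  have : Countable D := hD.to_subtype
  have hsubset : {x | ∃ μ ∈ empiricalLimits T x, measureEntropy T (μ : Measure X) ≤ t} ⊆
      ⋃ μ : D, {x | ∃ᶠ n in atTop, empiricalProbability T n x ∈ W μ} := by
    rintro x ⟨μ, hμ, hμt⟩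
    obtain ⟨ν, hν, hμν⟩ := Set.mem_iUnion₂.1
      (hcover ⟨measurePreserving_of_mem_empiricalLimits hT hμ, hμt⟩)
    exact Set.mem_iUnion.2 ⟨⟨ν, hν⟩, hμ.frequently (mem_interior_iff_mem_nhds.1 hμν)⟩
  refine le_antisymm ?_ bot_le
  calc bowenMeasure T {x | ∃ μ ∈ empiricalLimits T x, measureEntropy T (μ : Measure X) ≤ t} ε s
      ≤ ∑' μ : D, bowenMeasure T {x | ∃ᶠ n in atTop, empiricalProbability T n x ∈ W μ} ε s :=
        (bowenMeasure_mono hsubset ε s).trans (bowenMeasure_iUnion_le _ ε s)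
    _ = 0 := ENNReal.tsum_eq_zero.2 fun μ => hzero μ (hDM μ.2)

end BowenUpperBound

end SaturatedSystem

open SaturatedSystem in
theorem mainTheorem6_general {X : Type*} [MetricSpace X] [CompactSpace X] [MeasurableSpace X]
    [BorelSpace X] (T : X → X) (hT : Continuous T) (hsat : IsSaturated T) {ι : Type*}
    (Φ : ι → C(X, ℝ)) (a b : ι → ℝ) :
    topEntropy T (averageSet T Φ a b) = (⨆ μ ∈ measureSet T Φ a b, measureEntropy T μ) ∧
      (measureSet T Φ a b = ∅ → averageSet T Φ a b = ∅) := by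
  have hlimit : ∀ x ∈ averageSet T Φ a b, ∃ μ ∈ empiricalLimits T x,
      (μ : Measure X) ∈ measureSet T Φ a b := fun x hx =>
    (empiricalLimits_nonempty T x).imp fun μ hμ =>
      ⟨hμ, coe_mem_measureSet_of_mem_empiricalLimits hT hx hμ⟩
  refine ⟨le_antisymm ?_ (iSup₂_le fun μ hμ => ?_), fun hempty => ?_⟩
  · refine (topEntropy_mono fun x hx => ?_).trans (topEntropy_setOf_exists_empiricalLimits_le hT _)
    obtain ⟨μ, hμx, hμ⟩ := hlimit x hx
    exact ⟨μ, hμx, le_iSup₂ (f := fun μ _ => measureEntropy T μ) _ hμ⟩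
  · rw [← hsat μ hμ.1]
    exact topEntropy_mono (genericPoints_subset_averageSet hμ)
  · refine Set.eq_empty_of_forall_notMem fun x hx => ?_
    obtain ⟨μ, -, hμ⟩ := hlimit x hx
    exact hempty.subset hμ

theorem mainTheorem6 {X : Type*} [MetricSpace X] [CompactSpace X] [MeasurableSpace X]
    [BorelSpace X] (T : X → X) (hT : Continuous T) (hsat : SaturatedSystem.IsSaturated T)
    {ι : Type*} [Countable ι] (Φ : ι → C(X, ℝ)) (hΦ : ∃ C : ℝ, ∀ i x, |Φ i x| ≤ C)
    (a b : ι → ℝ) :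
    SaturatedSystem.topEntropy T (SaturatedSystem.averageSet T Φ a b) =
        (⨆ μ ∈ SaturatedSystem.measureSet T Φ a b, SaturatedSystem.measureEntropy T μ) ∧
      (SaturatedSystem.measureSet T Φ a b = ∅ → SaturatedSystem.averageSet T Φ a b = ∅) :=
  mainTheorem6_general T hT hsat Φ a b
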